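/- Let $k\in\{1,2\}$ and let $G$ be a finite simple graph. Call $G$ $k$-connected if $|V(G)|\ge k$ and $G-S$ is connected for every $S\subseteq V(G)$ with $|S|<k$. Let $\alpha(G)$ be the independence number (the maximum size of a set of pairwise non-adjacent vertices) and $\Delta(G)$ the maximum degree of $G$. If $G$ is $k$-connected and $\alpha(G)\le k+2$, then every longest path in $G$ (a path with the maximum number of edges among all paths of $G$) contains every vertex of $G$ of degree at least $\Delta(G)-(2-k)$. -/

import Mathlib

/-- A finite graph is `k`-connected if it has at least `k` vertices and deleting any set of fewer
than `k` vertices leaves a connected graph. -/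
def SimpleGraph.IsKConnected {V : Type*} [Fintype V] (G : SimpleGraph V) (k : ℕ) : Prop :=
  k ≤ Fintype.card V ∧ ∀ S : Finset V, S.card < k → (G.induce {v | v ∉ S}).Connected

/-- A longest path of `G`: a path whose length is at least that of every path of `G`, whatever the
endpoints of the latter. -/
def SimpleGraph.Walk.IsLongestPath {V : Type*} {G : SimpleGraph V} {x y : V}
    (P : G.Walk x y) : Prop :=
  P.IsPath ∧ ∀ (x' y' : V) (Q : G.Walk x' y'), Q.IsPath → Q.length ≤ P.length

/-! Suppose v lies off a longest path p 0, …, p m, in a component C of the rest, and let A index the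
path vertices with neighbours in C. The successors of those vertices, p 0 and any independent subset
of C form an independent set, since an edge among them would reroute the path into a longer one
(`card_add_card_lt_indepNum`). As α ≤ k + 2 and connectivity gives |A| ≥ k, exactly k indices occur
and C is a clique; hence deg v ≤ |C| - 1 + k.

It now suffices that some attachment vertex p i has degree at least |C| + 2, for then deg v < Δ - (2
- k). If p i misses some e in C, follow the neighbours of p i along the path from p 0 and from the
successor of each attachment vertex. If the degree is too small, these runs stop early, at
non-neighbours of p i. An edge between two of these would give a path that gains C and skips fewer
than |C| vertices. So they are independent together with e and p i: k + 3 vertices, a contradiction.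
-/

namespace SimpleGraph

/-! ### Paths with prescribed vertex set, cliques, independent lists -/

/-- `G.PathOn u v S` says that some path of `G` from `u` to `v` has vertex set exactly `S`. -/
def PathOn {V : Type*} (G : SimpleGraph V) (u v : V) (S : Finset V) : Prop :=
  ∃ w : G.Walk u v, w.IsPath ∧ ∀ z, z ∈ w.support ↔ z ∈ S

namespace PathOn

variable {V : Type*} {G : SimpleGraph V} {u v x y : V} {S T : Finset V}

theorem single (u : V) : G.PathOn u u {u} :=
  ⟨Walk.nil, Walk.IsPath.nil, by simp⟩

theorem symm (h : G.PathOn u v S) : G.PathOn v u S := by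
  obtain ⟨w, hw, hS⟩ := h
  exact ⟨w.reverse, hw.reverse, by simpa using hS⟩

theorem join [DecidableEq V] (h : G.PathOn u v S) (hvx : G.Adj v x) (h' : G.PathOn x y T)
    (hd : Disjoint S T) : G.PathOn u y (S ∪ T) := by
  obtain ⟨w, hw, hS⟩ := h
  obtain ⟨w', hw', hT⟩ := h'
  refine ⟨w.append (Walk.cons hvx w'), ?_, ?_⟩
  · rw [Walk.isPath_def, Walk.support_append, Walk.support_cons, List.tail_cons,
      List.nodup_append]
    refine ⟨hw.support_nodup, hw'.support_nodup, fun a ha b hb hab => ?_⟩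
    subst hab
    exact Finset.disjoint_left.1 hd ((hS a).1 ha) ((hT a).1 hb)
  · intro z
    rw [Walk.support_append, Walk.support_cons, List.tail_cons, List.mem_append, hS, hT,
      Finset.mem_union]

theorem left_mem (h : G.PathOn u v S) : u ∈ S := by
  obtain ⟨w, -, hS⟩ := h
  exact (hS u).1 w.start_mem_support

theorem card_eq (h : G.PathOn u v S) :
    ∃ w : G.Walk u v, w.IsPath ∧ w.length + 1 = S.card := by
  classical
  obtain ⟨w, hw, hS⟩ := h
  refine ⟨w, hw, ?_⟩
  rw [← Walk.length_support, ← List.toFinset_card_of_nodup hw.support_nodup]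
  congr 1
  ext z
  simp [hS]

end PathOn

/-- In a clique, any two distinct vertices are joined by a path through all its vertices. -/
theorem IsClique.pathOn {V : Type*} {G : SimpleGraph V} {C : Finset V}
    (hC : G.IsClique (C : Set V)) {c d : V} (hc : c ∈ C) (hd : d ∈ C) (hcd : c ≠ d) :
    G.PathOn c d C := by
  classical
  induction C using Finset.strongInduction generalizing c d with
  | H C ih =>
    have hsplit : C = {c} ∪ C.erase c := by
      ext z
      simp only [Finset.mem_union, Finset.mem_singleton, Finset.mem_erase]
      by_cases hz : z = c <;> simp [hz, hc]
    have hdis : Disjoint ({c} : Finset V) (C.erase c) := by simp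
    by_cases h : ∃ e ∈ C, e ≠ c ∧ e ≠ d
    · obtain ⟨e, he, hec, hed⟩ := h
      have h1 := ih (C.erase c) (Finset.erase_ssubset hc)
        (hC.subset (by simp)) (Finset.mem_erase.2 ⟨hec, he⟩)
        (Finset.mem_erase.2 ⟨hcd.symm, hd⟩) hed
      rw [hsplit]
      exact (PathOn.single c).join (hC hc he hec.symm) h1 hdis
    · push Not at h
      have h1 : C.erase c = {d} := by
        ext z
        simp only [Finset.mem_erase, Finset.mem_singleton]
        exact ⟨fun hz => h z hz.2 hz.1, fun hz => hz ▸ ⟨hcd.symm, hd⟩⟩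
      rw [hsplit, h1]
      rw [h1] at hdis
      exact (PathOn.single c).join (hC hc hd hcd) (PathOn.single d) hdis

/-- The list form lets an explicit tuple of vertices unfold into finitely many pair conditions. -/
theorem length_le_indepNum {V : Type*} [Finite V] {G : SimpleGraph V} {l : List V}
    (h : l.Pairwise fun a b => a ≠ b ∧ ¬ G.Adj a b) : l.length ≤ G.indepNum := by
  classical
  have hn : l.Nodup := h.imp fun h => h.1
  rw [← List.toFinset_card_of_nodup hn]
  apply IsIndepSet.card_le_indepNum
  intro a ha b hb hab
  have : Std.Symm fun a b => ¬ G.Adj a b := ⟨fun a b h hadj => h hadj.symm⟩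
  exact (List.Pairwise.imp (fun h => h.2) h).forall (by simpa using ha) (by simpa using hb) hab

/-- A connected vertex-deleted subgraph has an edge leaving each proper nonempty part. -/
theorem exists_adj_boundary {V : Type*} {G : SimpleGraph V} {S : Finset V}
    (h : (G.induce {v | v ∉ S}).Connected) {D : Set V} {a b : V}
    (haS : a ∉ S) (hbS : b ∉ S) (ha : a ∈ D) (hb : b ∉ D) :
    ∃ u w, u ∉ S ∧ w ∉ S ∧ u ∈ D ∧ w ∉ D ∧ G.Adj u w := by
  obtain ⟨q⟩ := h.preconnected ⟨a, haS⟩ ⟨b, hbS⟩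
  obtain ⟨d, -, h1, h2⟩ := q.exists_boundary_dart {z | (z : V) ∈ D} ha hb
  exact ⟨d.fst, d.snd, d.fst.2, d.snd.2, h1, h2, d.adj⟩

/-! ### Rerouting a longest path through a component -/

/-- `p 0, …, p m` is a longest path of `G` and `C` is (the vertex set of) a component of the graph
left after deleting it. -/
structure IsLongestPathComponent {V : Type*} (G : SimpleGraph V) (p : ℕ → V) (m : ℕ)
    (C : Finset V) : Prop where
  inj : ∀ i j, i ≤ m → j ≤ m → p i = p j → i = j
  adj : ∀ i < m, G.Adj (p i) (p (i + 1))
  card_le : ∀ (u v : V) (S : Finset V), G.PathOn u v S → S.card ≤ m + 1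
  off : ∀ i ≤ m, p i ∉ C
  closed : ∀ c ∈ C, ∀ w, G.Adj c w → w ∈ C ∨ ∃ i ≤ m, p i = w
  conn : ∀ c ∈ C, ∀ d ∈ C, ∃ S ⊆ C, G.PathOn c d S

namespace IsLongestPathComponent

variable {V : Type*} [DecidableEq V] {G : SimpleGraph V} {p : ℕ → V} {m : ℕ} {C : Finset V}

theorem pathOn_segment (h : G.IsLongestPathComponent p m C) {i j : ℕ} (hij : i ≤ j) (hj : j ≤ m) :
    G.PathOn (p i) (p j) ((Finset.Icc i j).image p) := by
  induction j, hij using Nat.le_induction with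
  | base => simpa using PathOn.single (p i)
  | succ j hij ih =>
    have h1 := (ih (by omega)).join (h.adj j (by omega)) (PathOn.single (p (j + 1))) (by
      rw [Finset.disjoint_singleton_right, Finset.mem_image]
      rintro ⟨r, hr, hrj⟩
      rw [Finset.mem_Icc] at hr
      have := h.inj r (j + 1) (by omega) hj hrj
      omega)
    convert h1 using 1
    ext z
    simp only [Finset.mem_image, Finset.mem_Icc, Finset.mem_union, Finset.mem_singleton]
    constructor
    · rintro ⟨r, hr, rfl⟩
      by_cases hrj : r = j + 1
      · exact Or.inr (by rw [hrj])
      · exact Or.inl ⟨r, by omega, rfl⟩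
    · rintro (⟨r, hr, rfl⟩ | rfl)
      · exact ⟨r, by omega, rfl⟩
      · exact ⟨j + 1, by omega, rfl⟩

theorem card_image (h : G.IsLongestPathComponent p m C) {F : Finset ℕ} (hF : ∀ i ∈ F, i ≤ m) :
    (F.image p).card = F.card :=
  Finset.card_image_of_injOn fun i hi j hj hij => h.inj i j (hF i hi) (hF j hj) hij

theorem disjoint_image (h : G.IsLongestPathComponent p m C) {F F' : Finset ℕ}
    (hF : ∀ i ∈ F, i ≤ m) (hF' : ∀ i ∈ F', i ≤ m) (hd : ∀ i ∈ F, i ∉ F') :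
    Disjoint (F.image p) (F'.image p) := by
  rw [Finset.disjoint_left]
  intro z hz hz'
  obtain ⟨i, hi, rfl⟩ := Finset.mem_image.1 hz
  obtain ⟨j, hj, hij⟩ := Finset.mem_image.1 hz'
  exact hd i hi (h.inj j i (hF' j hj) (hF i hi) hij ▸ hj)

theorem disjoint_segments (h : G.IsLongestPathComponent p m C) {i j i' j' : ℕ}
    (hj : j ≤ m) (hj' : j' ≤ m) (hd : j < i' ∨ j' < i) :
    Disjoint ((Finset.Icc i j).image p) ((Finset.Icc i' j').image p) := by
  apply h.disjoint_image <;> simp only [Finset.mem_Icc] <;> intros <;> omega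

theorem card_segment (h : G.IsLongestPathComponent p m C) {i j : ℕ} (hj : j ≤ m) :
    ((Finset.Icc i j).image p).card = j + 1 - i := by
  rw [h.card_image, Nat.card_Icc]
  intro r hr
  rw [Finset.mem_Icc] at hr
  omega

theorem disjoint_of_subset (h : G.IsLongestPathComponent p m C) {S : Finset V} (hS : S ⊆ C)
    {i j : ℕ} (hj : j ≤ m) : Disjoint S ((Finset.Icc i j).image p) := by
  rw [Finset.disjoint_right]
  intro z hz hzS
  obtain ⟨r, hr, rfl⟩ := Finset.mem_image.1 hz
  rw [Finset.mem_Icc] at hr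
  exact h.off r (by omega) (hS hzS)

variable {c d : V} {S : Finset V}

/-- Entering the path at p i from S trades p 0, …, p (i - 1) for S. The next lemma is the mirror
image. -/
theorem card_le_index (h : G.IsLongestPathComponent p m C) (hS : S ⊆ C) (hP : G.PathOn c d S)
    {i : ℕ} (hi : i ≤ m) (hd : G.Adj d (p i)) : S.card ≤ i := by
  have hdis := h.disjoint_of_subset hS (i := i) le_rfl
  have := h.card_le _ _ _ (hP.join hd (h.pathOn_segment hi le_rfl) hdis)
  rw [Finset.card_union_of_disjoint hdis, h.card_segment le_rfl] at this
  omega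

theorem card_add_index_le (h : G.IsLongestPathComponent p m C) (hS : S ⊆ C) (hP : G.PathOn c d S)
    {i : ℕ} (hi : i ≤ m) (hd : G.Adj d (p i)) : i + S.card ≤ m := by
  have hdis := h.disjoint_of_subset hS (i := 0) hi
  have := h.card_le _ _ _ (hP.join hd (h.pathOn_segment (Nat.zero_le i) hi).symm hdis)
  rw [Finset.card_union_of_disjoint hdis, h.card_segment hi] at this
  omega

/-- A detour through S trades the j - i - 1 vertices strictly between p i and p j for S. -/
theorem card_add_lt (h : G.IsLongestPathComponent p m C) (hS : S ⊆ C) (hP : G.PathOn c d S)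
    {i j : ℕ} (hij : i < j) (hj : j ≤ m) (hc : G.Adj (p i) c) (hd : G.Adj d (p j)) :
    i + S.card < j := by
  have h0 := (h.disjoint_of_subset hS (i := 0) (j := i) (by omega)).symm
  have h1 : Disjoint ((Finset.Icc 0 i).image p ∪ S) ((Finset.Icc j m).image p) := by
    rw [Finset.disjoint_union_left]
    exact ⟨h.disjoint_segments (by omega) le_rfl (by omega), h.disjoint_of_subset hS le_rfl⟩
  have := h.card_le _ _ _
    (((h.pathOn_segment (Nat.zero_le i) (by omega)).join hc hP h0).join hd
      (h.pathOn_segment hj le_rfl) h1)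
  rw [Finset.card_union_of_disjoint h1, Finset.card_union_of_disjoint h0, h.card_segment le_rfl,
    h.card_segment (by omega)] at this
  omega

/-- A chord from the part of the path before an attachment vertex to the part after it. -/
theorem card_lt_of_adj_start (h : G.IsLongestPathComponent p m C) (hS : S ⊆ C)
    (hP : G.PathOn c d S) {i s t : ℕ} (hd : G.Adj d (p i)) (hs : s ≤ i) (ht : i + 1 + t ≤ m)
    (hst : G.Adj (p s) (p (i + 1 + t))) : S.card ≤ s + t := by
  have h0 := h.disjoint_of_subset hS (i := s) (j := i) (by omega)
  have h1 : Disjoint (S ∪ (Finset.Icc s i).image p) ((Finset.Icc (i + 1 + t) m).image p) := by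
    rw [Finset.disjoint_union_left]
    exact ⟨h.disjoint_of_subset hS le_rfl, h.disjoint_segments (by omega) le_rfl (by omega)⟩
  -- The path runs through S, back from p i to p s, then from p (i + 1 + t) to p m, skipping s + t
  -- vertices.
  have := h.card_le _ _ _
    ((hP.join hd (h.pathOn_segment hs (by omega)).symm h0).join hst
      (h.pathOn_segment ht le_rfl) h1)
  rw [Finset.card_union_of_disjoint h1, Finset.card_union_of_disjoint h0, h.card_segment le_rfl,
    h.card_segment (by omega)] at this
  omega

/-- A chord between the parts of the path that follow two attachment vertices. -/
theorem card_le_of_adj (h : G.IsLongestPathComponent p m C) (hS : S ⊆ C)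
    (hP : G.PathOn c d S) {i j t u : ℕ} (hc : G.Adj (p i) c) (hd : G.Adj d (p j))
    (ht : i + 1 + t ≤ j) (hu : j + 1 + u ≤ m)
    (htu : G.Adj (p (i + 1 + t)) (p (j + 1 + u))) : S.card ≤ t + u := by
  have h0 := (h.disjoint_of_subset hS (i := 0) (j := i) (by omega)).symm
  have h1 : Disjoint ((Finset.Icc 0 i).image p ∪ S) ((Finset.Icc (i + 1 + t) j).image p) := by
    rw [Finset.disjoint_union_left]
    exact ⟨h.disjoint_segments (by omega) (by omega) (by omega),
      h.disjoint_of_subset hS (by omega)⟩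
  have h2 : Disjoint (((Finset.Icc 0 i).image p ∪ S) ∪ (Finset.Icc (i + 1 + t) j).image p)
      ((Finset.Icc (j + 1 + u) m).image p) := by
    rw [Finset.disjoint_union_left, Finset.disjoint_union_left]
    exact ⟨⟨h.disjoint_segments (by omega) le_rfl (by omega), h.disjoint_of_subset hS le_rfl⟩,
      h.disjoint_segments (by omega) le_rfl (by omega)⟩
  -- The path runs from p 0 to p i, through S, back from p j to p (i + 1 + t), then from p (j + 1 +
  -- u) to p m, skipping t + u vertices.
  have := h.card_le _ _ _
    ((((h.pathOn_segment (Nat.zero_le i) (by omega)).join hc hP h0).join hd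
      (h.pathOn_segment ht (by omega)).symm h1).join htu (h.pathOn_segment hu le_rfl) h2)
  rw [Finset.card_union_of_disjoint h2, Finset.card_union_of_disjoint h1,
    Finset.card_union_of_disjoint h0, h.card_segment le_rfl, h.card_segment (by omega),
    h.card_segment (by omega)] at this
  omega

end IsLongestPathComponent

end SimpleGraph

/-- Either `Q` holds below `n` or it first fails at some `s < n`. -/
theorem Nat.forall_lt_or_exists_first (Q : ℕ → Prop) (n : ℕ) :
    (∀ r < n, Q r) ∨ ∃ s < n, ¬ Q s ∧ ∀ r < s, Q r := by
  classical
  by_cases h : ∃ s, s < n ∧ ¬ Q s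
  · right
    obtain ⟨h1, h2⟩ := Nat.find_spec h
    refine ⟨Nat.find h, h1, h2, fun r hr => ?_⟩
    by_contra hQ
    exact Nat.find_min h hr ⟨by omega, hQ⟩
  · left
    push Not at h
    exact h

namespace SimpleGraph

/-! ### Independent successors and degrees of attachment vertices -/

namespace IsLongestPathComponent

variable {V : Type*} [DecidableEq V] {G : SimpleGraph V} {p : ℕ → V} {m : ℕ} {C : Finset V}

theorem index_pos (h : G.IsLongestPathComponent p m C) {i : ℕ} {c : V} (hi : i ≤ m) (hc : c ∈ C)
    (hic : G.Adj (p i) c) : 0 < i := by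
  have := h.card_le_index (Finset.singleton_subset_iff.2 hc) (PathOn.single c) hi hic.symm
  rw [Finset.card_singleton] at this
  omega

theorem index_lt (h : G.IsLongestPathComponent p m C) {i : ℕ} {c : V} (hi : i ≤ m) (hc : c ∈ C)
    (hic : G.Adj (p i) c) : i < m := by
  have := h.card_add_index_le (Finset.singleton_subset_iff.2 hc) (PathOn.single c) hi hic.symm
  rw [Finset.card_singleton] at this
  omega

theorem not_adj_succ (h : G.IsLongestPathComponent p m C) {i : ℕ} {c d : V} (hi : i + 1 ≤ m)
    (hc : c ∈ C) (hd : d ∈ C) (hic : G.Adj (p i) c) : ¬ G.Adj d (p (i + 1)) := by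
  intro hid
  obtain ⟨S, hS, hP⟩ := h.conn c hc d hd
  have := h.card_add_lt hS hP (Nat.lt_succ_self i) hi hic hid
  have := Finset.card_pos.2 ⟨c, hP.left_mem⟩
  omega

/-- The first vertex of a longest path and the successors of the attachment vertices of `C` form
an independent set, which can be enlarged by any independent subset of `C`. -/
theorem card_add_card_lt_indepNum [Finite V] (h : G.IsLongestPathComponent p m C) {J : Finset V}
    (hJ : G.IsIndepSet (J : Set V)) (hJC : J ⊆ C) {A : Finset ℕ}
    (hA : ∀ i ∈ A, i ≤ m ∧ ∃ c ∈ C, G.Adj (p i) c) :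
    J.card + A.card < G.indepNum := by
  have hlt : ∀ i ∈ A, i + 1 ≤ m := by
    intro i hi
    obtain ⟨him, c, hc, hic⟩ := hA i hi
    exact h.index_lt him hc hic
  set F : Finset ℕ := insert 0 (A.image Nat.succ) with hF
  have hmem : ∀ r, r ∈ F → r = 0 ∨ ∃ i ∈ A, r = i + 1 := by
    intro r hr
    rw [hF, Finset.mem_insert, Finset.mem_image] at hr
    rcases hr with hr | ⟨i, hi, rfl⟩
    · exact Or.inl hr
    · exact Or.inr ⟨i, hi, rfl⟩
  have hFm : ∀ r ∈ F, r ≤ m := by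
    intro r hr
    rcases hmem r hr with rfl | ⟨i, hi, rfl⟩
    · exact Nat.zero_le m
    · exact hlt i hi
  have hFc : F.card = A.card + 1 := by
    rw [hF, Finset.card_insert_of_notMem (by simp),
      Finset.card_image_of_injective _ Nat.succ_injective]
  have hJF : ∀ c ∈ C, ∀ r ∈ F, ¬ G.Adj c (p r) := by
    intro c hc r hr hadj
    rcases hmem r hr with rfl | ⟨i, hi, rfl⟩
    · exact (h.index_pos (Nat.zero_le m) hc hadj.symm).ne rfl
    · obtain ⟨him, d, hd, hid⟩ := hA i hi
      exact h.not_adj_succ (hlt i hi) hd hc hid hadj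
  have hFF : ∀ r ∈ F, ∀ r' ∈ F, r < r' → ¬ G.Adj (p r) (p r') := by
    intro r hr r' hr' hlt' hadj
    rcases hmem r' hr' with rfl | ⟨j, hj, rfl⟩
    · omega
    obtain ⟨hjm, d, hd, hjd⟩ := hA j hj
    rcases hmem r hr with rfl | ⟨i, hi, rfl⟩
    · have := h.card_lt_of_adj_start (Finset.singleton_subset_iff.2 hd) (PathOn.single d)
        (i := j) (s := 0) (t := 0) hjd.symm (Nat.zero_le j) (hlt j hj) hadj
      simp at this
    · obtain ⟨him, c, hc, hic⟩ := hA i hi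
      obtain ⟨S, hS, hP⟩ := h.conn c hc d hd
      have := h.card_le_of_adj hS hP (t := 0) (u := 0) hic hjd.symm (by omega) (hlt j hj) hadj
      have := Finset.card_pos.2 ⟨c, hP.left_mem⟩
      omega
  have hdis : Disjoint J (F.image p) := by
    rw [Finset.disjoint_right]
    intro z hz hzJ
    obtain ⟨r, hr, rfl⟩ := Finset.mem_image.1 hz
    exact h.off r (hFm r hr) (hJC hzJ)
  have hind : G.IsIndepSet ((J ∪ F.image p : Finset V) : Set V) := by
    intro a ha b hb hab hadj
    rw [Finset.mem_coe, Finset.mem_union, Finset.mem_image] at ha hb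
    rcases ha with ha | ⟨r, hr, rfl⟩ <;> rcases hb with hb | ⟨r', hr', rfl⟩
    · exact hJ ha hb hab hadj
    · exact hJF a (hJC ha) r' hr' hadj
    · exact hJF b (hJC hb) r hr hadj.symm
    · rcases lt_trichotomy r r' with hlt | rfl | hlt
      · exact hFF r hr r' hr' hlt hadj
      · exact hab rfl
      · exact hFF r' hr' r hr hlt hadj.symm
  have := hind.card_le_indepNum
  rw [Finset.card_union_of_disjoint hdis, h.card_image hFm, hFc] at this
  omega

/-- The 2 counts c and p (i - 1); `s < i` keeps the latter out of the first run. Here j merely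
separates the last two runs. -/
theorem le_degree (h : G.IsLongestPathComponent p m C) {i j s t u : ℕ} {c : V}
    [Fintype (G.neighborSet (p i))] (hc : c ∈ C) (hic : G.Adj (p i) c) (hs : s < i)
    (ht : i + 1 + t ≤ j + 1) (hj : j < m) (hu : j + u ≤ m)
    (hsa : ∀ r < s, G.Adj (p i) (p r)) (hta : ∀ r < t, G.Adj (p i) (p (i + 1 + r)))
    (hua : ∀ r < u, G.Adj (p i) (p (j + 1 + r))) : s + t + u + 2 ≤ G.degree (p i) := by
  have hFm : ∀ r ∈ Finset.range s ∪ {i - 1} ∪ Finset.Ico (i + 1) (i + 1 + t) ∪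
      Finset.Ico (j + 1) (j + 1 + u), r ≤ m := by
    intro r hr
    simp only [Finset.mem_union, Finset.mem_range, Finset.mem_singleton, Finset.mem_Ico] at hr
    omega
  have hcard : (Finset.range s ∪ {i - 1} ∪ Finset.Ico (i + 1) (i + 1 + t) ∪
      Finset.Ico (j + 1) (j + 1 + u)).card = s + 1 + t + u := by
    rw [Finset.card_union_of_disjoint, Finset.card_union_of_disjoint,
      Finset.card_union_of_disjoint]
    · simp
    all_goals
      rw [Finset.disjoint_left]
      intro r
      simp only [Finset.mem_union, Finset.mem_range, Finset.mem_singleton, Finset.mem_Ico]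
      omega
  rw [← card_neighborFinset_eq_degree]
  refine le_trans ?_ (Finset.card_le_card (s := insert c ((Finset.range s ∪ {i - 1} ∪
    Finset.Ico (i + 1) (i + 1 + t) ∪ Finset.Ico (j + 1) (j + 1 + u)).image p)) ?_)
  · rw [Finset.card_insert_of_notMem, h.card_image hFm, hcard]
    · omega
    · intro hcm
      obtain ⟨r, hr, rfl⟩ := Finset.mem_image.1 hcm
      exact h.off r (hFm r hr) hc
  · intro z hz
    rw [mem_neighborFinset]
    rcases Finset.mem_insert.1 hz with rfl | hz
    · exact hic
    obtain ⟨r, hr, rfl⟩ := Finset.mem_image.1 hz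
    simp only [Finset.mem_union, Finset.mem_range, Finset.mem_singleton, Finset.mem_Ico] at hr
    rcases hr with ((hr | rfl) | hr) | hr
    · exact hsa r hr
    · have := h.adj (i - 1) (by omega)
      rw [Nat.sub_add_cancel (by omega)] at this
      exact this.symm
    · have := hta (r - (i + 1)) (by omega)
      rwa [show i + 1 + (r - (i + 1)) = r by omega] at this
    · have := hua (r - (j + 1)) (by omega)
      rwa [show j + 1 + (r - (j + 1)) = r by omega] at this

theorem card_add_two_le_degree_of_complete (h : G.IsLongestPathComponent p m C) {i : ℕ}
    [Fintype (G.neighborSet (p i))] (hi0 : 0 < i) (hi : i < m)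
    (hC : ∀ c ∈ C, G.Adj (p i) c) : C.card + 2 ≤ G.degree (p i) := by
  have hne : p (i - 1) ≠ p (i + 1) := fun he => by
    have := h.inj _ _ (by omega) (by omega) he
    omega
  rw [← card_neighborFinset_eq_degree]
  refine le_trans ?_ (Finset.card_le_card (s := C ∪ {p (i - 1), p (i + 1)}) ?_)
  · rw [Finset.card_union_of_disjoint, Finset.card_pair hne]
    simp [h.off (i - 1) (by omega), h.off (i + 1) (by omega)]
  · intro z hz
    rw [mem_neighborFinset]
    simp only [Finset.mem_union, Finset.mem_insert, Finset.mem_singleton] at hz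
    rcases hz with hz | rfl | rfl
    · exact hC z hz
    · have := h.adj (i - 1) (by omega)
      rw [Nat.sub_add_cancel (by omega)] at this
      exact this.symm
    · exact h.adj i hi

theorem ne_of_ne {V : Type*} {G : SimpleGraph V} {p : ℕ → V} {m : ℕ} {C : Finset V}
    (h : G.IsLongestPathComponent p m C) {i j : ℕ}
    (hi : i ≤ m) (hj : j ≤ m) (hij : i ≠ j) : p i ≠ p j := fun he => hij (h.inj i j hi hj he)

theorem card_add_two_le_degree_of_unique [Finite V] (h : G.IsLongestPathComponent p m C)
    (hα : G.indepNum ≤ 3) {i : ℕ} [Fintype (G.neighborSet (p i))]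
    (hi : i ≤ m) (huniq : ∀ r ≤ m, ∀ c ∈ C, G.Adj (p r) c → r = i)
    {c d : V} (hc : c ∈ C) (hic : G.Adj (p i) c) (hP : G.PathOn d c C) :
    C.card + 2 ≤ G.degree (p i) := by
  have hn := Finset.card_pos.2 ⟨c, hc⟩
  have h1 := h.card_le_index subset_rfl hP hi hic.symm
  have h2 := h.card_add_index_le subset_rfl hP hi hic.symm
  by_cases hall : ∀ e ∈ C, G.Adj (p i) e
  · exact h.card_add_two_le_degree_of_complete (by omega) (by omega) hall
  push Not at hall
  obtain ⟨e, he, hie⟩ := hall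
  have hnext := h.adj i (by omega)
  have hdeg : ∀ s t, s < i → i + 1 + t ≤ m + 1 → (∀ r < s, G.Adj (p i) (p r)) →
      (∀ r < t, G.Adj (p i) (p (i + 1 + r))) → s + t + 2 ≤ G.degree (p i) := by
    intro s t hs ht hsa hta
    -- When the second run reaches p m, its last vertex is counted as a third run, because
    -- `le_degree` needs j < m.
    rcases Nat.lt_or_ge (i + t) m with hlt | hge
    · simpa using h.le_degree (j := i + t) (u := 0) hc hic hs (by omega) (by omega) (by omega)
        hsa hta (by simp)
    · have := h.le_degree (j := m - 1) (t := t - 1) (u := 1) hc hic hs (by omega) (by omega)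
        (by omega) hsa (fun r hr => hta r (by omega)) (fun r hr => by
          have := hta (t - 1) (by omega)
          rwa [show m - 1 + 1 + r = i + 1 + (t - 1) by omega])
      omega
  rcases Nat.forall_lt_or_exists_first (fun r => G.Adj (p i) (p r)) C.card with
    hs | ⟨s, hsn, hs, hsa⟩
  -- Possibly |C| = i, so a first run of length |C| could count p (i - 1) twice; p (i + 1) replaces
  -- the last vertex.
  · have := hdeg (C.card - 1) 1 (by omega) (by omega) (fun r hr => hs r (by omega))
      (fun r hr => by rwa [show r = 0 by omega])
    omega
  rcases Nat.forall_lt_or_exists_first (fun r => G.Adj (p i) (p (i + 1 + r))) C.card with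
    ht | ⟨t, htn, ht, hta⟩
  · have := hdeg 0 C.card (by omega) (by omega) (by simp) ht
    omega
  have hst := hdeg s t (by omega) (by omega) hsa hta
  by_contra hlt
  have hx : ¬ G.Adj (p s) (p (i + 1 + t)) := fun hadj => by
    have := h.card_lt_of_adj_start subset_rfl hP hic.symm (by omega) (by omega) hadj
    omega
  have hout : ∀ r ≤ m, r ≠ i → e ≠ p r ∧ ¬ G.Adj e (p r) := fun r hr hri =>
    ⟨fun heq => h.off r hr (heq ▸ he), fun hadj => hri (huniq r hr e he hadj.symm)⟩
  have := length_le_indepNum (G := G) (l := [e, p i, p s, p (i + 1 + t)]) (by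
    simp only [List.pairwise_cons, List.mem_cons, List.not_mem_nil, or_false, forall_eq_or_imp,
      forall_eq, IsEmpty.forall_iff, implies_true, List.Pairwise.nil, and_true]
    refine ⟨⟨⟨fun heq => h.off i hi (heq ▸ he), fun hadj => hie hadj.symm⟩,
      hout s (by omega) (by omega), hout _ (by omega) (by omega)⟩,
      ⟨⟨h.ne_of_ne (by omega) (by omega) (by omega), hs⟩,
      h.ne_of_ne (by omega) (by omega) (by omega), ht⟩,
      h.ne_of_ne (by omega) (by omega) (by omega), hx⟩)
  simp only [List.length_cons, List.length_nil] at this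
  omega

theorem card_add_two_le_degree_of_pair [Finite V] (h : G.IsLongestPathComponent p m C)
    (hα : G.indepNum ≤ 4) {i j : ℕ} [Fintype (G.neighborSet (p i))] (hij : i < j)
    (hj : j ≤ m) (huniq : ∀ r ≤ m, ∀ c ∈ C, G.Adj (p r) c → r = i ∨ r = j)
    {c d : V} (hc : c ∈ C) (hic : G.Adj (p i) c) (hjd : G.Adj d (p j))
    (hP : G.PathOn c d C) : C.card + 2 ≤ G.degree (p i) := by
  have hn := Finset.card_pos.2 ⟨c, hc⟩
  have hi : i ≤ m := by omega
  have h1 := h.card_le_index subset_rfl hP.symm hi hic.symm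
  have h2 := h.card_add_lt subset_rfl hP hij hj hic hjd
  have h3 := h.card_add_index_le subset_rfl hP hj hjd
  by_cases hall : ∀ e ∈ C, G.Adj (p i) e
  · exact h.card_add_two_le_degree_of_complete (by omega) (by omega) hall
  push Not at hall
  obtain ⟨e, he, hie⟩ := hall
  have hnext := h.adj i (by omega)
  rcases Nat.forall_lt_or_exists_first (fun r => G.Adj (p i) (p r)) C.card with
    hs | ⟨s, hsn, hs, hsa⟩
  · have := h.le_degree (s := C.card - 1) (t := 1) (u := 0) (j := j) hc hic (by omega) (by omega)
      (by omega) (by omega) (fun r hr => hs r (by omega))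
      (fun r hr => by rwa [show r = 0 by omega]) (by simp)
    omega
  rcases Nat.forall_lt_or_exists_first (fun r => G.Adj (p i) (p (i + 1 + r))) C.card with
    ht | ⟨t, htn, ht, hta⟩
  · have := h.le_degree (s := 0) (t := C.card) (u := 0) (j := j) hc hic (by omega) (by omega)
      (by omega) (by omega) (by simp) ht (by simp)
    omega
  rcases Nat.forall_lt_or_exists_first (fun r => G.Adj (p i) (p (j + 1 + r))) C.card with
    hu | ⟨u, hun, hu, hua⟩
  · have := h.le_degree (s := 0) (t := 0) (u := C.card) (j := j) hc hic (by omega) (by omega)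
      (by omega) (by omega) (by simp) (by simp) hu
    omega
  have hstu := h.le_degree hc hic (by omega) (by omega) (by omega) (by omega) hsa hta hua
  by_contra hlt
  have hx : ¬ G.Adj (p s) (p (i + 1 + t)) := fun hadj => by
    have := h.card_lt_of_adj_start subset_rfl hP.symm hic.symm (by omega) (by omega) hadj
    omega
  -- This rerouting leaves C through p j instead of p i.
  have hy : ¬ G.Adj (p s) (p (j + 1 + u)) := fun hadj => by
    have := h.card_lt_of_adj_start subset_rfl hP hjd (by omega) (by omega) hadj
    omega
  have hz : ¬ G.Adj (p (i + 1 + t)) (p (j + 1 + u)) := fun hadj => by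
    have := h.card_le_of_adj subset_rfl hP hic hjd (by omega) (by omega) hadj
    omega
  have hout : ∀ r ≤ m, r ≠ i → r ≠ j → e ≠ p r ∧ ¬ G.Adj e (p r) := fun r hr hri hrj =>
    ⟨fun heq => h.off r hr (heq ▸ he),
      fun hadj => (huniq r hr e he hadj.symm).elim hri hrj⟩
  have := length_le_indepNum (G := G)
    (l := [e, p i, p s, p (i + 1 + t), p (j + 1 + u)]) (by
    simp only [List.pairwise_cons, List.mem_cons, List.not_mem_nil, or_false, forall_eq_or_imp,
      forall_eq, IsEmpty.forall_iff, implies_true, List.Pairwise.nil, and_true]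
    refine ⟨⟨⟨fun heq => h.off i hi (heq ▸ he), fun hadj => hie hadj.symm⟩,
      hout s (by omega) (by omega) (by omega), hout _ (by omega) (by omega) (by omega),
      hout _ (by omega) (by omega) (by omega)⟩,
      ⟨⟨h.ne_of_ne (by omega) (by omega) (by omega), hs⟩,
      ⟨h.ne_of_ne (by omega) (by omega) (by omega), ht⟩,
      h.ne_of_ne (by omega) (by omega) (by omega), hu⟩,
      ⟨⟨h.ne_of_ne (by omega) (by omega) (by omega), hx⟩,
      h.ne_of_ne (by omega) (by omega) (by omega), hy⟩,
      h.ne_of_ne (by omega) (by omega) (by omega), hz⟩)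
  simp only [List.length_cons, List.length_nil] at this
  omega

end IsLongestPathComponent

end SimpleGraph

/-! ### The component of an omitted vertex, and the theorem -/

namespace SimpleGraph

theorem Walk.IsLongestPath.isLongestPathComponent {V : Type*} [DecidableEq V] {G : SimpleGraph V}
    {x y : V} {P : G.Walk x y} (hP : P.IsLongestPath) {v : V} {C : Finset V}
    (hC : ∀ w, w ∈ C ↔ ∃ q : G.Walk v w, ∀ z ∈ q.support, z ∉ P.support) :
    G.IsLongestPathComponent P.getVert P.length C where
  inj i j hi hj hij := hP.1.getVert_injOn hi hj hij
  adj i hi := P.adj_getVert_succ hi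
  card_le u w S h := by
    obtain ⟨q, hq, hqS⟩ := h.card_eq
    rw [← hqS]
    exact Nat.succ_le_succ (hP.2 _ _ q hq)
  off i _ h := by
    obtain ⟨q, hq⟩ := (hC _).1 h
    exact hq _ q.end_mem_support (P.getVert_mem_support i)
  closed c hc w hcw := by
    by_cases hw : w ∈ P.support
    · obtain ⟨r, hr, hrm⟩ := Walk.mem_support_iff_exists_getVert.1 hw
      exact Or.inr ⟨r, hrm, hr⟩
    · obtain ⟨q, hq⟩ := (hC c).1 hc
      refine Or.inl ((hC w).2 ⟨q.concat hcw, fun z hz => ?_⟩)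
      simp only [Walk.support_concat, List.mem_append, List.mem_singleton] at hz
      rcases hz with hz | rfl
      · exact hq z hz
      · exact hw
  conn c hc d hd := by
    obtain ⟨q, hq⟩ := (hC c).1 hc
    obtain ⟨q', hq'⟩ := (hC d).1 hd
    -- Both walks start at v and avoid P, so initial segments of them show that every vertex met
    -- lies in C.
    refine ⟨(q.reverse.append q').bypass.support.toFinset, fun z hz => ?_,
      (q.reverse.append q').bypass, Walk.bypass_isPath _, by simp⟩
    rw [List.mem_toFinset] at hz
    have hz := Walk.support_bypass_subset_support _ hz
    rw [Walk.mem_support_append_iff, Walk.support_reverse, List.mem_reverse] at hz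
    rcases hz with hz | hz
    · exact (hC z).2 ⟨q.takeUntil z hz,
        fun a ha => hq a (q.support_takeUntil_subset_support hz ha)⟩
    · exact (hC z).2 ⟨q'.takeUntil z hz,
        fun a ha => hq' a (q'.support_takeUntil_subset_support hz ha)⟩

end SimpleGraph

theorem theorem13 {V : Type*} [Fintype V] (G : SimpleGraph V) [DecidableRel G.Adj]
    (k : ℕ) (hk : k = 1 ∨ k = 2) (hconn : G.IsKConnected k) (hα : G.indepNum ≤ k + 2)
    {x y : V} (P : G.Walk x y) (hP : P.IsLongestPath)
    (v : V) (hv : (G.maxDegree : ℤ) - (2 - (k : ℤ)) ≤ (G.degree v : ℤ)) :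
    v ∈ P.support := by
  classical
  by_contra hvP
  obtain ⟨C, hC⟩ : ∃ C : Finset V, ∀ w, w ∈ C ↔
      ∃ q : G.Walk v w, ∀ z ∈ q.support, z ∉ P.support :=
    ⟨Finset.univ.filter fun w => ∃ q : G.Walk v w, ∀ z ∈ q.support, z ∉ P.support, by simp⟩
  have h := hP.isLongestPathComponent hC
  have hvC : v ∈ C := (hC v).2 ⟨SimpleGraph.Walk.nil, by simpa using hvP⟩
  generalize P.getVert = p at h
  generalize P.length = m at h
  obtain ⟨A, hA⟩ : ∃ A : Finset ℕ, ∀ i, i ∈ A ↔ i ≤ m ∧ ∃ c ∈ C, G.Adj (p i) c :=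
    ⟨(Finset.range (m + 1)).filter fun i => ∃ c ∈ C, G.Adj (p i) c, by simp⟩
  have hle : A.card ≤ k := by
    have := h.card_add_card_lt_indepNum (J := {v}) (by simp) (by simpa using hvC)
      (fun i hi => (hA i).1 hi)
    rw [Finset.card_singleton] at this
    omega
  -- Deleting the attachment vertices separates v from p 0, which is not one of them.
  have hge : k ≤ A.card := by
    by_contra hlt
    have h0 : p 0 ∉ A.image p := by
      intro h0
      obtain ⟨r, hr, hr0⟩ := Finset.mem_image.1 h0
      obtain ⟨hrm, c, hc, hrc⟩ := (hA r).1 hr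
      have := h.index_pos hrm hc hrc
      have := h.inj r 0 hrm (Nat.zero_le m) hr0
      omega
    have hvA : v ∉ A.image p := by
      intro hvA
      obtain ⟨r, hr, rfl⟩ := Finset.mem_image.1 hvA
      exact h.off r ((hA r).1 hr).1 hvC
    obtain ⟨u, w, -, hwA, huC, hwC, huw⟩ := SimpleGraph.exists_adj_boundary (D := (C : Set V))
      (hconn.2 (A.image p) (Finset.card_image_le.trans_lt (by omega))) hvA h0 hvC
      (h.off 0 (Nat.zero_le m))
    rcases h.closed u huC w huw with hw | ⟨r, hr, rfl⟩
    · exact hwC hw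
    · exact hwA (Finset.mem_image_of_mem p ((hA r).2 ⟨hr, u, huC, huw.symm⟩))
  have hclique : G.IsClique (C : Set V) := by
    intro c hc d hd hcd
    by_contra hadj
    have := h.card_add_card_lt_indepNum (J := {c, d})
      (by
        rw [Finset.coe_pair]
        exact Set.pairwise_pair.2 fun _ => ⟨hadj, fun h => hadj h.symm⟩)
      (Finset.insert_subset hc (Finset.singleton_subset_iff.2 hd))
      (fun i hi => (hA i).1 hi)
    rw [Finset.card_pair hcd] at this
    omega
  have hdeg : G.degree v + 1 ≤ C.card + k := by
    have hsub : G.neighborFinset v ⊆ C.erase v ∪ A.image p := by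
      intro z hz
      rw [SimpleGraph.mem_neighborFinset] at hz
      rw [Finset.mem_union, Finset.mem_erase]
      rcases h.closed v hvC z hz with hzC | ⟨r, hr, rfl⟩
      · exact Or.inl ⟨hz.ne', hzC⟩
      · exact Or.inr (Finset.mem_image_of_mem p ((hA r).2 ⟨hr, v, hvC, hz.symm⟩))
    have h1 := (Finset.card_le_card hsub).trans (Finset.card_union_le _ _)
    have h2 := Finset.card_image_le (s := A) (f := p)
    have h3 := Finset.card_pos.2 ⟨v, hvC⟩
    rw [SimpleGraph.card_neighborFinset_eq_degree, Finset.card_erase_of_mem hvC] at h1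
    omega
  suffices ∃ i, C.card + 2 ≤ G.degree (p i) by
    obtain ⟨i, hi⟩ := this
    have := G.degree_le_maxDegree (p i)
    omega
  rcases hk with rfl | rfl
  · obtain ⟨i, rfl⟩ := Finset.card_eq_one.1 (le_antisymm hle hge)
    obtain ⟨him, c, hc, hic⟩ := (hA i).1 (Finset.mem_singleton_self i)
    obtain ⟨d, hd⟩ : ∃ d, G.PathOn d c C := by
      by_cases hex : ∃ d ∈ C, d ≠ c
      · obtain ⟨d, hd, hdc⟩ := hex
        exact ⟨d, hclique.pathOn hd hc hdc⟩
      · push Not at hex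
        exact ⟨c, Finset.eq_singleton_iff_unique_mem.2 ⟨hc, hex⟩ ▸ SimpleGraph.PathOn.single c⟩
    exact ⟨i, h.card_add_two_le_degree_of_unique hα him
      (fun r hr e he hre => Finset.mem_singleton.1 ((hA r).2 ⟨hr, e, he, hre⟩)) hc hic hd⟩
  · obtain ⟨i, j, hij, hAij⟩ : ∃ i j, i < j ∧ A = {i, j} := by
      obtain ⟨i, j, hij, hAij⟩ := Finset.card_eq_two.1 (le_antisymm hle hge)
      rcases hij.lt_or_gt with hlt | hlt
      · exact ⟨i, j, hlt, hAij⟩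
      · exact ⟨j, i, hlt, by rw [hAij, Finset.pair_comm]⟩
    have huniq : ∀ r ≤ m, ∀ c ∈ C, G.Adj (p r) c → r = i ∨ r = j := fun r hr c hc hrc => by
      simpa [hAij] using (hA r).2 ⟨hr, c, hc, hrc⟩
    obtain ⟨him, c, hc, hic⟩ := (hA i).1 (by simp [hAij])
    obtain ⟨hjm, d, hd, hjd⟩ := (hA j).1 (by simp [hAij])
    have main : ∀ c d, c ∈ C → G.Adj (p i) c → G.Adj (p j) d → G.PathOn c d C →
        ∃ i, C.card + 2 ≤ G.degree (p i) := fun c d hc hic hjd hcd =>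
      ⟨i, h.card_add_two_le_degree_of_pair hα hij hjm huniq hc hic hjd.symm hcd⟩
    by_cases hcd : c = d
    · subst hcd
      by_cases hex : ∃ z ∈ C, z ≠ c
      · obtain ⟨z, hz, hzc⟩ := hex
        have h0 : p 0 ≠ c := fun h0 => h.off 0 (Nat.zero_le m) (h0 ▸ hc)
        -- Deleting c leaves the rest of C joined to p 0, so some u ≠ c in C is adjacent to p i or p
        -- j. This gives distinct ends for a path spanning C.
        obtain ⟨u, w, huc, -, huC, hwC, huw⟩ :=
          SimpleGraph.exists_adj_boundary (D := (C : Set V)) (hconn.2 {c} (by simp))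
            (by simpa using hzc) (by simpa using h0) hz (h.off 0 (Nat.zero_le m))
        rw [Finset.mem_singleton] at huc
        rcases h.closed u huC w huw with hw | ⟨r, hr, rfl⟩
        · exact absurd hw hwC
        · rcases huniq r hr u huC huw.symm with rfl | rfl
          · exact main u c huC huw.symm hjd (hclique.pathOn huC hc huc)
          · exact main c u hc hic huw.symm (hclique.pathOn hc huC (Ne.symm huc))
      · push Not at hex
        exact main c c hc hic hjd
          (Finset.eq_singleton_iff_unique_mem.2 ⟨hc, hex⟩ ▸ SimpleGraph.PathOn.single c)
    · exact main c d hc hic hjd (hclique.pathOn hc hd hcd)
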